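/- Throughout, let $R$ be an integral domain with quotient field $K$. For a nonzero ideal $I$ of $R$ put $I^{-1}=(R:I)=\{x\in K : xI\subseteq R\}$ and $I^v=(I^{-1})^{-1}$; the ideal $I$ is called divisorial if $I=I^v$ (and similarly for the ideals of the localizations $R_M$). The domain $R$ is a Prüfer domain if every nonzero finitely generated ideal of $R$ is invertible. It is $h$-local if each nonzero element of $R$ lies in only finitely many maximal ideals and each nonzero prime ideal of $R$ is contained in a unique maximal ideal. A Prüfer domain $R$ has the strong factorization property if for each nonzero ideal $I$ of $R$ the set $\{M_1,\dots,M_n\}$ of all nondivisorial maximal ideals $M\supseteq I$ for which $IR_M$ is a nondivisorial ideal of $R_M$ is finite (possibly empty), $I=I^vM_1\cdots M_n$ (the empty product being $R$), and this factorization is irredundant, that is, no $M_i$ can be omitted from it. **Theorem.** Let $R$ be a Prüfer domain. The following are equivalent: 1. $R$ is $h$-local. 2. $R$ has the strong factorization property. 3. For each nonzero ideal $I$ of $R$, $I$ is divisorial if and only if $IR_M$ is divisorial in $R_M$ for each maximal ideal $M$ of $R$. 4. For each nonzero ideal $I$ of $R$, if $IR_M$ is divisorial in $R_M$ for each maximal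 ideal $M$ of $R$, then $I$ is divisorial. -/

import Mathlib

open scoped nonZeroDivisors

/-- A Prüfer domain: an integral domain in which every nonzero finitely generated ideal is
invertible (as a fractional ideal). -/
def IsPruferDomain (R : Type*) [CommRing R] [IsDomain R] : Prop :=
  ∀ I : Ideal R, I ≠ ⊥ → I.FG → IsUnit (I : FractionalIdeal R⁰ (FractionRing R))

/-- Finite character: each nonzero element lies in only finitely many maximal ideals. -/
def HasFiniteCharacter (R : Type*) [CommRing R] : Prop :=
  ∀ x : R, x ≠ 0 → {M : MaximalSpectrum R | x ∈ M.asIdeal}.Finite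

/-- `h`-local: finite character, and each nonzero prime ideal is contained in a unique maximal
ideal. -/
def IsHLocal (R : Type*) [CommRing R] : Prop :=
  HasFiniteCharacter R ∧
    ∀ P : Ideal R, P.IsPrime → P ≠ ⊥ → ∃! M : MaximalSpectrum R, P ≤ M.asIdeal

/-- The divisorial closure `I^v = (I⁻¹)⁻¹`, where `J⁻¹ = (R : J) = {x ∈ K | x J ⊆ R}` for a nonzero
fractional ideal `J` and `K` is the fraction field of `R`. It is only used for nonzero `I`. -/
noncomputable def divisorialClosure {R : Type*} [CommRing R] [IsDomain R] (I : Ideal R) :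
    FractionalIdeal R⁰ (FractionRing R) :=
  ((I : FractionalIdeal R⁰ (FractionRing R))⁻¹)⁻¹

/-- `I` is divisorial: `I^v = I`. -/
def IsDivisorial {R : Type*} [CommRing R] [IsDomain R] (I : Ideal R) : Prop :=
  divisorialClosure I = (I : FractionalIdeal R⁰ (FractionRing R))

/-- The extension `I R_M` is a divisorial ideal of the localization `R_M`. -/
def IsDivisorialAt {R : Type*} [CommRing R] [IsDomain R] (I : Ideal R) (M : MaximalSpectrum R) :
    Prop :=
  IsDivisorial (I.map (algebraMap R (Localization.AtPrime M.asIdeal)))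

/-- The strong factorization property: for each nonzero ideal `I`, the set `S` of nondivisorial
maximal ideals `M` containing `I` for which `I R_M` is nondivisorial is finite, `I` is the product
of `I^v` and the members of `S`, and no member of `S` can be omitted from this product. -/
def HasStrongFactorization (R : Type*) [CommRing R] [IsDomain R] : Prop :=
  ∀ I : Ideal R, I ≠ ⊥ → ∃ S : Finset (MaximalSpectrum R),
    (∀ M : MaximalSpectrum R,
      M ∈ S ↔ I ≤ M.asIdeal ∧ ¬ IsDivisorial M.asIdeal ∧ ¬ IsDivisorialAt I M) ∧
    (I : FractionalIdeal R⁰ (FractionRing R)) =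
      divisorialClosure I * ((∏ M ∈ S, M.asIdeal : Ideal R) : FractionalIdeal R⁰ (FractionRing R)) ∧
    ∀ T : Finset (MaximalSpectrum R), T ⊂ S →
      (I : FractionalIdeal R⁰ (FractionRing R)) ≠
        divisorialClosure I *
          ((∏ M ∈ T, M.asIdeal : Ideal R) : FractionalIdeal R⁰ (FractionRing R))

/-! The implications proved are 1 → 2 → 4 → 1 and 1 → 3 → 4.

From 1: `HasSeparators` gives, for x ≠ 0 and M maximal, some c ∉ M with c/x in every other R_N.
Hence (R : I), and with it I^v, commutes with localization, which is 3. Since R_M is a valuation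
ring, (I R_M)^v is either I R_M or z R_M with I R_M = z M R_M; checking I = I^v M₁⋯Mₙ locally gives
2.

From 4: the hypothesis is applied to two kinds of locally divisorial ideals, nonmaximal primes P and
J = x R_M ∩ R. If M ≠ N share a nonzero prime, let P be the greatest one in M ∩ N. Divisoriality of
the ideals J forces (R : P) = R, so P^v = R, although P is divisorial (`eq_bot_of_le_of_le`). Once
distinct maximal ideals share no nonzero prime, J^v = J yields s ∉ M lying in every other maximal
ideal that contains x, and compactness gives finite character (`hasFiniteCharacter_of_separated`).
-/

set_option linter.unusedSectionVars false

/-! ### Divisorial closure in terms of elements -/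

section Elementwise

variable {A : Type*} [CommRing A] [IsDomain A]

/-- The elements of the fraction field that multiply `I` into `B`. -/
def mulInto (B : Subalgebra A (FractionRing A)) (I : Ideal A) : Set (FractionRing A) :=
  {t | ∀ i ∈ I, t * algebraMap A (FractionRing A) i ∈ B}

lemma mem_inv_coeIdeal_iff {I : Ideal A} (hI : I ≠ ⊥) (t : FractionRing A) :
    t ∈ (I : FractionalIdeal A⁰ (FractionRing A))⁻¹ ↔ t ∈ mulInto ⊥ I := by
  rw [FractionalIdeal.mem_inv_iff (by simpa using hI)]
  constructor
  · intro h i hi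
    have := h _ (FractionalIdeal.mem_coeIdeal_of_mem A⁰ hi)
    rw [FractionalIdeal.mem_one_iff] at this
    exact Algebra.mem_bot.2 this
  · intro h y hy
    obtain ⟨i, hi, rfl⟩ := (FractionalIdeal.mem_coeIdeal A⁰).1 hy
    rw [FractionalIdeal.mem_one_iff]
    exact Algebra.mem_bot.1 (h i hi)

lemma one_mem_mulInto (B : Subalgebra A (FractionRing A)) (I : Ideal A) : 1 ∈ mulInto B I :=
  fun i _ => by rw [one_mul]; exact B.algebraMap_mem i

lemma mem_divisorialClosure_iff {I : Ideal A} (hI : I ≠ ⊥) (z : FractionRing A) :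
    z ∈ divisorialClosure I ↔
      ∀ t ∈ mulInto ⊥ I, t * z ∈ (⊥ : Subalgebra A (FractionRing A)) := by
  have h1 : (1 : FractionRing A) ∈ (I : FractionalIdeal A⁰ (FractionRing A))⁻¹ :=
    (mem_inv_coeIdeal_iff hI 1).2 (one_mem_mulInto _ _)
  have h0 : (I : FractionalIdeal A⁰ (FractionRing A))⁻¹ ≠ 0 := by
    intro h
    rw [h, FractionalIdeal.mem_zero_iff] at h1
    exact one_ne_zero h1
  rw [divisorialClosure, FractionalIdeal.mem_inv_iff h0]
  simp_rw [mem_inv_coeIdeal_iff hI, FractionalIdeal.mem_one_iff, mul_comm z]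
  rfl

/-- The divisorial closure `I^v` as an ideal. -/
def vIdeal (I : Ideal A) : Ideal A where
  carrier := {z | ∀ t ∈ mulInto ⊥ I, t * algebraMap A (FractionRing A) z ∈
    (⊥ : Subalgebra A (FractionRing A))}
  zero_mem' t _ := by simp
  add_mem' {x y} hx hy t ht := by
    rw [map_add, mul_add]
    exact add_mem (hx t ht) (hy t ht)
  smul_mem' c x hx t ht := by
    rw [smul_eq_mul, map_mul, mul_left_comm]
    exact mul_mem (Subalgebra.algebraMap_mem _ c) (hx t ht)

lemma mem_vIdeal {I : Ideal A} {z : A} :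
    z ∈ vIdeal I ↔ ∀ t ∈ mulInto ⊥ I, t * algebraMap A (FractionRing A) z ∈
      (⊥ : Subalgebra A (FractionRing A)) := Iff.rfl

lemma le_vIdeal (I : Ideal A) : I ≤ vIdeal I := fun i hi _ ht => ht i hi

lemma divisorialClosure_eq {I : Ideal A} (hI : I ≠ ⊥) :
    divisorialClosure I = (vIdeal I : FractionalIdeal A⁰ (FractionRing A)) := by
  ext z
  rw [mem_divisorialClosure_iff hI, FractionalIdeal.mem_coeIdeal]
  constructor
  · intro h
    obtain ⟨r, rfl⟩ := Algebra.mem_bot.1 (by simpa using h 1 (one_mem_mulInto _ _))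
    exact ⟨r, h, rfl⟩
  · rintro ⟨r, h, rfl⟩
    exact h

lemma isDivisorial_iff_vIdeal_le {I : Ideal A} (hI : I ≠ ⊥) : IsDivisorial I ↔ vIdeal I ≤ I := by
  rw [IsDivisorial, divisorialClosure_eq hI, FractionalIdeal.coeIdeal_inj]
  exact ⟨fun h => h.le, fun h => le_antisymm h (le_vIdeal I)⟩

lemma div_mem_bot_iff {a b : A} (hb : b ≠ 0) :
    algebraMap A (FractionRing A) a / algebraMap A (FractionRing A) b ∈
      (⊥ : Subalgebra A (FractionRing A)) ↔ b ∣ a := by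
  have hb' : algebraMap A (FractionRing A) b ≠ 0 := by simpa using hb
  rw [Algebra.mem_bot]
  constructor
  · rintro ⟨c, hc⟩
    refine ⟨c, IsFractionRing.injective A (FractionRing A) ?_⟩
    rw [map_mul, hc]
    field_simp
  · rintro ⟨c, rfl⟩
    refine ⟨c, ?_⟩
    rw [map_mul]
    field_simp

/-- Mentioning only divisibility in the ring, this form transfers to R_P without comparing two
fraction fields. -/
lemma isDivisorial_iff_dvd {I : Ideal A} (hI : I ≠ ⊥) :
    IsDivisorial I ↔
      ∀ z, (∀ a b : A, b ≠ 0 → (∀ i ∈ I, b ∣ a * i) → b ∣ a * z) → z ∈ I := by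
  rw [isDivisorial_iff_vIdeal_le hI]
  refine forall_congr' fun z => imp_congr_left ?_
  rw [mem_vIdeal]
  constructor
  · intro h a b hb hab
    have := h (algebraMap A _ a / algebraMap A _ b) fun i hi => by
      rw [div_mul_eq_mul_div, ← map_mul, div_mem_bot_iff hb]
      exact hab i hi
    rwa [div_mul_eq_mul_div, ← map_mul, div_mem_bot_iff hb] at this
  · intro h t ht
    obtain ⟨a, b, hb, rfl⟩ := IsFractionRing.div_surjective (A := A) t
    have hb : b ≠ 0 := nonZeroDivisors.ne_zero hb
    rw [div_mul_eq_mul_div, ← map_mul, div_mem_bot_iff hb]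
    refine h a b hb fun i hi => ?_
    have := ht i hi
    rwa [div_mul_eq_mul_div, ← map_mul, div_mem_bot_iff hb] at this

end Elementwise

/-! ### Localizations as subrings of K -/

section Localization

variable {R : Type*} [CommRing R] [IsDomain R]

local notation "ι" => algebraMap R (FractionRing R)

/-- The localization `R_P` inside the fraction field. -/
noncomputable abbrev localAt (P : Ideal R) [P.IsPrime] : Subalgebra R (FractionRing R) :=
  Localization.subalgebra.ofField (FractionRing R) P.primeCompl P.primeCompl_le_nonZeroDivisors

lemma algebraMap_ne_zero {a : R} (ha : a ≠ 0) : ι a ≠ 0 := by simpa using ha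

lemma ne_zero_of_notMem {P : Ideal R} {s : R} (hs : s ∉ P) : s ≠ 0 :=
  fun h => hs (h ▸ P.zero_mem)

lemma mem_localAt {P : Ideal R} [P.IsPrime] {x : FractionRing R} :
    x ∈ localAt P ↔ ∃ s ∉ P, ∃ a, ι s * x = ι a := by
  constructor
  · rintro ⟨a, s, hs, rfl⟩
    have : ι s ≠ 0 := algebraMap_ne_zero (ne_zero_of_notMem hs)
    exact ⟨s, hs, a, by field_simp⟩
  · rintro ⟨s, hs, a, h⟩
    have : ι s ≠ 0 := algebraMap_ne_zero (ne_zero_of_notMem hs)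
    exact ⟨a, s, hs, by rw [← h]; field_simp⟩

lemma inv_mem_localAt {P : Ideal R} [P.IsPrime] {s : R} (hs : s ∉ P) : (ι s)⁻¹ ∈ localAt P :=
  mem_localAt.2 ⟨s, hs, 1, by
    rw [mul_inv_cancel₀ (algebraMap_ne_zero (ne_zero_of_notMem hs)), map_one]⟩

lemma mem_localAt_of_mul_mem {P : Ideal R} [P.IsPrime] {s : R} (hs : s ∉ P) {x : FractionRing R}
    (h : ι s * x ∈ localAt P) : x ∈ localAt P := by
  have := mul_mem (inv_mem_localAt hs) h
  rwa [inv_mul_cancel_left₀ (algebraMap_ne_zero (ne_zero_of_notMem hs))] at this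

lemma div_mem_localAt_iff {P : Ideal R} [P.IsPrime] {a b : R} (hb : b ≠ 0) :
    ι a / ι b ∈ localAt P ↔ ∃ s ∉ P, b ∣ s * a := by
  rw [mem_localAt]
  have hb' := algebraMap_ne_zero hb
  refine exists_congr fun s => and_congr_right fun _ => exists_congr fun c => ?_
  rw [← (IsFractionRing.injective R (FractionRing R)).eq_iff, map_mul, map_mul]
  field_simp

lemma mem_bot_iff_forall_localAt {x : FractionRing R} :
    x ∈ (⊥ : Subalgebra R (FractionRing R)) ↔
      ∀ M : MaximalSpectrum R, x ∈ localAt M.asIdeal := by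
  rw [← MaximalSpectrum.iInf_localization_eq_bot, Algebra.mem_iInf]

/-- `z` lies in the localization of `I` at `P`. -/
def MemLocally (P I : Ideal R) (z : R) : Prop := ∃ s ∉ P, s * z ∈ I

lemma mem_of_forall_memLocally {I : Ideal R} {z : R}
    (h : ∀ M : MaximalSpectrum R, MemLocally M.asIdeal I z) : z ∈ I := by
  by_contra hz
  have hne : I.colon {z} ≠ ⊤ := fun h => hz <| by
    simpa [Submodule.mem_colon_singleton] using (Ideal.eq_top_iff_one _).1 h
  obtain ⟨M, hM, hle⟩ := Ideal.exists_le_maximal _ hne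
  obtain ⟨s, hs, hsz⟩ := h ⟨M, hM⟩
  exact hs (hle (Submodule.mem_colon_singleton.2 hsz))

section AtPrime

variable (P : Ideal R) [P.IsPrime]

local notation "f" => algebraMap R (Localization.AtPrime P)

lemma algebraMap_atPrime_injective : Function.Injective f :=
  IsLocalization.injective _ P.primeCompl_le_nonZeroDivisors

lemma exists_associated_algebraMap (x : Localization.AtPrime P) : ∃ r : R, Associated x (f r) := by
  obtain ⟨⟨r, s⟩, h⟩ := IsLocalization.surj P.primeCompl x
  exact ⟨r, (IsLocalization.map_units _ s).unit, h⟩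

lemma algebraMap_dvd_algebraMap_iff {a b : R} : f b ∣ f a ↔ ∃ s ∉ P, b ∣ s * a := by
  constructor
  · rintro ⟨c, hc⟩
    obtain ⟨⟨r, s⟩, h⟩ := IsLocalization.surj P.primeCompl c
    refine ⟨s, s.2, r, algebraMap_atPrime_injective P ?_⟩
    rw [map_mul, map_mul, hc, ← h]
    ring
  · rintro ⟨s, hs, h⟩
    have hu : IsUnit (f s) := IsLocalization.map_units _ (⟨s, hs⟩ : P.primeCompl)
    have := map_dvd f h
    rw [map_mul] at this
    exact hu.dvd_mul_left.1 this

lemma algebraMap_mem_map_iff {I : Ideal R} {z : R} : f z ∈ I.map f ↔ MemLocally P I z := by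
  rw [IsLocalization.mem_map_algebraMap_iff P.primeCompl]
  constructor
  · rintro ⟨⟨i, s⟩, h⟩
    refine ⟨s, s.2, ?_⟩
    rw [← map_mul] at h
    rw [mul_comm, algebraMap_atPrime_injective P h]
    exact i.2
  · rintro ⟨s, hs, h⟩
    exact ⟨(⟨s * z, h⟩, ⟨s, hs⟩), by rw [← map_mul, mul_comm]⟩

/-- Up to units, elements of R_P come from R, so divisoriality over R_P can be tested inside K with
elements of R. -/
lemma isDivisorial_map_iff {I : Ideal R} (hI : I ≠ ⊥) :
    IsDivisorial (I.map f) ↔ ∀ z : R, (∀ t ∈ mulInto (localAt P) I, t * ι z ∈ localAt P) →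
      MemLocally P I z := by
  have hI' : I.map f ≠ ⊥ := by
    rwa [Ne, Ideal.map_eq_bot_iff_of_injective (algebraMap_atPrime_injective P)]
  have hinj := algebraMap_atPrime_injective P
  rw [isDivisorial_iff_dvd hI']
  constructor
  · intro h z hz
    rw [← algebraMap_mem_map_iff]
    refine h _ fun a b hb hab => ?_
    obtain ⟨a', ha'⟩ := exists_associated_algebraMap P a
    obtain ⟨b', hb'⟩ := exists_associated_algebraMap P b
    have hb0 : b' ≠ 0 := by
      rintro rfl
      rw [map_zero] at hb'
      exact hb ((associated_zero_iff_eq_zero _).1 hb')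
    rw [(ha'.mul_right (f z)).dvd_iff_dvd_right, hb'.dvd_iff_dvd_left, ← map_mul,
      algebraMap_dvd_algebraMap_iff, ← div_mem_localAt_iff hb0, map_mul, ← div_mul_eq_mul_div]
    refine hz _ fun i hi => ?_
    rw [div_mul_eq_mul_div, ← map_mul, div_mem_localAt_iff hb0, ← algebraMap_dvd_algebraMap_iff,
      ← hb'.dvd_iff_dvd_left, map_mul, ← (ha'.mul_right (f i)).dvd_iff_dvd_right]
    exact hab _ (Ideal.mem_map_of_mem _ hi)
  · intro h z hz
    obtain ⟨z', hz'⟩ := exists_associated_algebraMap P z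
    rw [Ideal.mem_iff_of_associated hz', algebraMap_mem_map_iff]
    refine h z' fun t ht => ?_
    obtain ⟨a, b, hb, rfl⟩ := IsFractionRing.div_surjective (A := R) t
    have hb : b ≠ 0 := nonZeroDivisors.ne_zero hb
    rw [div_mul_eq_mul_div, ← map_mul, div_mem_localAt_iff hb, ← algebraMap_dvd_algebraMap_iff,
      map_mul, ← (hz'.mul_left (f a)).dvd_iff_dvd_right]
    refine hz _ _ (by rwa [Ne, map_eq_zero_iff _ hinj]) fun i hi => ?_
    obtain ⟨⟨j, s⟩, hj⟩ := (IsLocalization.mem_map_algebraMap_iff P.primeCompl _).1 hi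
    have hu : IsUnit (f s) := IsLocalization.map_units _ s
    rw [← hu.dvd_mul_right, mul_assoc, hj, ← map_mul, algebraMap_dvd_algebraMap_iff,
      ← div_mem_localAt_iff hb, map_mul, ← div_mul_eq_mul_div]
    exact ht j j.2

end AtPrime

lemma isDivisorialAt_iff {I : Ideal R} (hI : I ≠ ⊥) (M : MaximalSpectrum R) :
    IsDivisorialAt I M ↔
      ∀ z : R, (∀ t ∈ mulInto (localAt M.asIdeal) I, t * ι z ∈ localAt M.asIdeal) →
        MemLocally M.asIdeal I z :=
  isDivisorial_map_iff M.asIdeal hI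

end Localization

/-! ### The localizations of a Prüfer domain are valuation rings -/

section Valuation

variable {R : Type*} [CommRing R] [IsDomain R]

local notation "ι" => algebraMap R (FractionRing R)

lemma algebraMap_notMem_iff {P : Ideal R} [P.IsPrime] {m : R} (hm : m ≠ 0) :
    (ι m)⁻¹ ∈ localAt P ↔ m ∉ P := by
  refine ⟨fun h hmP => ?_, inv_mem_localAt⟩
  rw [← one_div, ← map_one ι, div_mem_localAt_iff hm] at h
  obtain ⟨s, hs, c, hc⟩ := h
  rw [mul_one] at hc
  exact hs (hc ▸ P.mul_mem_right c hmP)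

lemma IsPruferDomain.mem_or_inv_mem (hR : IsPruferDomain R) (P : Ideal R) [P.IsPrime]
    (x : FractionRing R) : x ∈ localAt P ∨ x⁻¹ ∈ localAt P := by
  obtain ⟨a, b, hb, rfl⟩ := IsFractionRing.div_surjective (A := R) x
  have hb : b ≠ 0 := nonZeroDivisors.ne_zero hb
  rcases eq_or_ne a 0 with rfl | ha
  · exact Or.inl (by simp)
  have hb' := algebraMap_ne_zero hb
  have ha' := algebraMap_ne_zero ha
  by_contra! hcon
  have hI : Ideal.span {a, b} ≠ ⊥ := fun h =>
    hb ((Ideal.span_eq_bot.1 h) b (by simp))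
  have hu := hR _ hI (Submodule.fg_span (Set.toFinite _))
  rw [← FractionalIdeal.mul_inv_cancel_iff_isUnit] at hu
  -- If neither a/b nor b/a is in R_P, every j in (a, b)⁻¹ has ja, jb ∈ P, because b/a = jb/ja. So
  -- (a, b)(a, b)⁻¹ ⊆ P, against invertibility.
  have hle : ((Ideal.span {a, b} : Ideal R) : FractionalIdeal R⁰ (FractionRing R)) *
      ((Ideal.span {a, b} : Ideal R) : FractionalIdeal R⁰ (FractionRing R))⁻¹ ≤
      (P : FractionalIdeal R⁰ (FractionRing R)) := by
    rw [FractionalIdeal.mul_le]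
    intro i hi j hj
    obtain ⟨i, hi', rfl⟩ := (FractionalIdeal.mem_coeIdeal R⁰).1 hi
    rw [mem_inv_coeIdeal_iff hI] at hj
    obtain ⟨c, hc⟩ := Algebra.mem_bot.1 (hj a (Ideal.subset_span (by simp)))
    obtain ⟨d, hd⟩ := Algebra.mem_bot.1 (hj b (Ideal.subset_span (by simp)))
    obtain ⟨r, s, rfl⟩ := Ideal.mem_span_pair.1 hi'
    have hcP : c ∈ P := by
      by_contra hcP
      refine hcon.2 (mem_localAt.2 ⟨c, hcP, d, ?_⟩)
      rw [hc, hd]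
      field_simp
    have hdP : d ∈ P := by
      by_contra hdP
      refine hcon.1 (mem_localAt.2 ⟨d, hdP, c, ?_⟩)
      rw [hc, hd]
      field_simp
    refine (FractionalIdeal.mem_coeIdeal R⁰).2
      ⟨r * c + s * d, P.add_mem (P.mul_mem_left r hcP) (P.mul_mem_left s hdP), ?_⟩
    simp only [map_add, map_mul, hc, hd]
    ring
  rw [hu, ← FractionalIdeal.coeIdeal_top, FractionalIdeal.coeIdeal_le_coeIdeal] at hle
  exact Ideal.IsPrime.ne_top ‹_› (top_le_iff.1 hle)

/-- The local divisorial closure: `z ∈ (I R_P)^v`. -/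
def MemLocalV (P : Ideal R) [P.IsPrime] (I : Ideal R) (z : R) : Prop :=
  ∀ t ∈ mulInto (localAt P) I, t * ι z ∈ localAt P

lemma memLocally_of_div_mem {P I : Ideal R} [P.IsPrime] {y z : R} (hy : MemLocally P I y)
    (hy0 : y ≠ 0) (h : ι z / ι y ∈ localAt P) : MemLocally P I z := by
  obtain ⟨s, hs, c, hc⟩ := (div_mem_localAt_iff hy0).1 h
  obtain ⟨u, hu, hy⟩ := hy
  refine ⟨u * s, P.primeCompl.mul_mem hu hs, ?_⟩
  rw [mul_assoc, hc, ← mul_assoc]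
  exact I.mul_mem_right c hy

lemma memLocally_of_mem {P I : Ideal R} [P.IsPrime] {y : R} (hy : y ∈ I) : MemLocally P I y :=
  ⟨1, P.one_notMem, by rwa [one_mul]⟩

lemma div_mem_of_not_memLocally (hR : IsPruferDomain R) {P I : Ideal R} [P.IsPrime] {y z : R}
    (hy : y ∈ I) (hz : ¬ MemLocally P I z) : ι y / ι z ∈ localAt P := by
  rcases eq_or_ne y 0 with rfl | hy0
  · simp
  refine (hR.mem_or_inv_mem P (ι y / ι z)).resolve_right fun h => hz ?_
  rw [inv_div] at h
  exact memLocally_of_div_mem (memLocally_of_mem hy) hy0 h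

/-- If zm ∉ I R_P, then I R_P ⊆ zm R_P, so 1/(zm) carries I into R_P; applied to z this puts 1/m in
R_P. -/
lemma MemLocalV.mul_mem (hR : IsPruferDomain R) {P I : Ideal R} [P.IsPrime] {z m : R}
    (hz : MemLocalV P I z) (hm : m ∈ P) : MemLocally P I (z * m) := by
  by_contra hcon
  have h0 : z * m ≠ 0 := fun h => hcon ⟨1, P.one_notMem, by simp [h]⟩
  have h := hz (ι (z * m))⁻¹ fun i hi => by
    rw [inv_mul_eq_div]
    exact div_mem_of_not_memLocally hR hi hcon
  have hz0 := algebraMap_ne_zero (left_ne_zero_of_mul h0)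
  have e : (ι (z * m))⁻¹ * ι z = (ι m)⁻¹ := by
    rw [map_mul, mul_inv, mul_right_comm, inv_mul_cancel₀ hz0, one_mul]
  rw [e, algebraMap_notMem_iff (right_ne_zero_of_mul h0)] at h
  exact h hm

lemma exists_mul_eq_of_not_memLocally (hR : IsPruferDomain R) {P I : Ideal R} [P.IsPrime]
    {y z : R} (hy : y ∈ I) (hz : ¬ MemLocally P I z) : ∃ s ∉ P, ∃ m ∈ P, s * y = z * m := by
  have hz0 : z ≠ 0 := by
    rintro rfl
    exact hz ⟨1, P.one_notMem, by simp⟩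
  obtain ⟨s, hs, m, hm⟩ := (div_mem_localAt_iff hz0).1 (div_mem_of_not_memLocally hR hy hz)
  refine ⟨s, hs, m, ?_, hm⟩
  by_contra hmP
  exact hz ⟨m, hmP, by rw [mul_comm, ← hm]; exact I.mul_mem_left s hy⟩

lemma isDivisorialAt_of_not_le {I : Ideal R} (hI : I ≠ ⊥) {M : MaximalSpectrum R}
    (h : ¬ I ≤ M.asIdeal) : IsDivisorialAt I M := by
  obtain ⟨i, hi, hiM⟩ := SetLike.not_le_iff_exists.1 h
  exact (isDivisorialAt_iff hI M).2 fun z _ => ⟨i, hiM, I.mul_mem_right z hi⟩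

lemma exists_notMem_of_ne {M N : MaximalSpectrum R} (h : M ≠ N) :
    ∃ m ∈ M.asIdeal, m ∉ N.asIdeal :=
  SetLike.not_le_iff_exists.1 fun hle =>
    h (MaximalSpectrum.ext (M.isMaximal.eq_of_le N.isMaximal.ne_top hle))

lemma mem_localAt_of_mem_mulInto {I : Ideal R} {P : Ideal R} [P.IsPrime] {t : FractionRing R}
    (ht : t ∈ mulInto (localAt P) I) {i : R} (hi : i ∈ I) (hiP : i ∉ P) : t ∈ localAt P :=
  mem_localAt_of_mul_mem hiP (by rw [mul_comm]; exact ht i hi)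

lemma mulInto_bot_subset (B : Subalgebra R (FractionRing R)) (I : Ideal R) :
    mulInto ⊥ I ⊆ mulInto B I := fun _ ht i hi => bot_le (a := B) (ht i hi)

/-- Divisoriality of M gives t ∉ R_M with tM ⊆ R. For z in (I R_M)^v outside I R_M one has I R_M ⊆ z
M R_M, so t/z carries I into R_M and t = (t/z)z ∈ R_M, a contradiction. -/
lemma isDivisorialAt_of_isDivisorial (hR : IsPruferDomain R) {M : MaximalSpectrum R}
    (hM : IsDivisorial M.asIdeal) {I : Ideal R} (hI : I ≠ ⊥) : IsDivisorialAt I M := by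
  by_cases hIM : I ≤ M.asIdeal
  swap
  · exact isDivisorialAt_of_not_le hI hIM
  rw [isDivisorial_iff_vIdeal_le (ne_bot_of_le_ne_bot hI hIM)] at hM
  have h1 : (1 : R) ∉ vIdeal M.asIdeal := fun h => M.asIdeal.one_notMem (hM h)
  rw [mem_vIdeal] at h1
  push Not at h1
  obtain ⟨t, ht, h1⟩ := h1
  rw [map_one, mul_one, mem_bot_iff_forall_localAt] at h1
  have htM : t ∉ localAt M.asIdeal := fun htM => h1 fun N => by
    rcases eq_or_ne M N with rfl | hMN
    · exact htM
    obtain ⟨m, hm, hmN⟩ := exists_notMem_of_ne hMN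
    exact mem_localAt_of_mem_mulInto (mulInto_bot_subset _ _ ht) hm hmN
  rw [isDivisorialAt_iff hI]
  intro z hz
  by_contra hcon
  have hz0 : ι z ≠ 0 := algebraMap_ne_zero fun h => hcon ⟨1, M.asIdeal.one_notMem, by simp [h]⟩
  refine htM ?_
  have := hz (t / ι z) fun i hi => by
    obtain ⟨s, hs, m, hm, e⟩ := exists_mul_eq_of_not_memLocally hR hi hcon
    refine mem_localAt_of_mul_mem hs ?_
    have e' := congrArg ι e
    rw [map_mul, map_mul] at e'
    have : ι s * (t / ι z * ι i) = t * ι m := by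
      rw [show ι s * (t / ι z * ι i) = t / ι z * (ι s * ι i) by ring, e']
      field_simp
    rw [this]
    exact mulInto_bot_subset _ _ ht m hm
  rwa [div_mul_cancel₀ _ hz0] at this

end Valuation

/-! ### Consequences of h-locality -/

section HLocal

variable {R : Type*} [CommRing R] [IsDomain R]

local notation "ι" => algebraMap R (FractionRing R)

/-- Otherwise some prime containing r avoids (R∖M)(R∖N); it lies in M ∩ N, hence in P. -/
lemma exists_dvd_mul_of_notMem {M N P : Ideal R} [M.IsPrime] [N.IsPrime]
    (h : ∀ Q : Ideal R, Q.IsPrime → Q ≤ M → Q ≤ N → Q ≤ P) {r : R} (hr : r ∉ P) :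
    ∃ m ∉ M, ∃ n ∉ N, r ∣ m * n := by
  by_contra! hcon
  obtain ⟨Q, hQ, hle, hdis⟩ := Ideal.exists_le_prime_disjoint (Ideal.span {r})
    (M.primeCompl ⊔ N.primeCompl) (by
      rw [Set.disjoint_left]
      intro x hx hxS
      obtain ⟨m, hm, n, hn, rfl⟩ := Submonoid.mem_sup.1 hxS
      exact hcon m hm n hn (Ideal.mem_span_singleton.1 hx))
  rw [Set.disjoint_left] at hdis
  refine hr (h Q hQ ?_ ?_ (hle (Ideal.mem_span_singleton_self r)))
  · intro x hx
    by_contra hxM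
    exact hdis hx ((le_sup_left : M.primeCompl ≤ _) hxM)
  · intro x hx
    by_contra hxN
    exact hdis hx ((le_sup_right : N.primeCompl ≤ _) hxN)

/-- Maximal ideals are separated: for each maximal `M`, the localization `R_M` and the intersection
of the other localizations generate the fraction field. -/
def HasSeparators (R : Type*) [CommRing R] [IsDomain R] : Prop :=
  ∀ (M : MaximalSpectrum R) (x : R), x ≠ 0 → ∃ c ∉ M.asIdeal, ∀ N ≠ M,
    algebraMap R (FractionRing R) c / algebraMap R (FractionRing R) x ∈ localAt N.asIdeal

lemma exists_div_mem_localAt {M N : MaximalSpectrum R}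
    (h : ∀ Q : Ideal R, Q.IsPrime → Q ≤ M.asIdeal → Q ≤ N.asIdeal → Q = ⊥) {x : R} (hx : x ≠ 0) :
    ∃ c ∉ M.asIdeal, ι c / ι x ∈ localAt N.asIdeal := by
  obtain ⟨m, hm, n, hn, hdvd⟩ := exists_dvd_mul_of_notMem (M := M.asIdeal) (N := N.asIdeal)
    (P := ⊥) (fun Q hQ h1 h2 => (h Q hQ h1 h2).le) hx
  exact ⟨m, hm, (div_mem_localAt_iff hx).2 ⟨n, hn, by rwa [mul_comm]⟩⟩

lemma IsHLocal.hasSeparators (h : IsHLocal R) : HasSeparators R := by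
  classical
  intro M x hx
  have hN : ∀ N : MaximalSpectrum R, ∃ c ∉ M.asIdeal, N ≠ M → ι c / ι x ∈ localAt N.asIdeal := by
    intro N
    by_cases hNM : N = M
    · exact ⟨1, M.asIdeal.one_notMem, fun h => (h hNM).elim⟩
    obtain ⟨c, hc, hcx⟩ := exists_div_mem_localAt (M := M) (N := N) (fun Q hQ h1 h2 => by
      by_contra hQ0
      exact hNM ((h.2 Q hQ hQ0).unique h2 h1)) hx
    exact ⟨c, hc, fun _ => hcx⟩
  choose c hc hcx using hN
  -- Only the finitely many N containing x need a factor: elsewhere x is a unit of R_N.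
  refine ⟨∏ N ∈ (h.1 x hx).toFinset, c N, ?_, fun N hNM => ?_⟩
  · exact M.asIdeal.primeCompl.prod_mem fun N _ => hc N
  by_cases hxN : x ∈ N.asIdeal
  · have hmem : N ∈ (h.1 x hx).toFinset := by simpa using hxN
    rw [← Finset.mul_prod_erase _ _ hmem, map_mul, mul_div_right_comm]
    exact mul_mem (hcx N hNM) (Subalgebra.algebraMap_mem _ _)
  · rw [div_eq_mul_inv]
    exact mul_mem (Subalgebra.algebraMap_mem _ _) (inv_mem_localAt hxN)

lemma HasSeparators.exists_mul_mem_mulInto (h : HasSeparators R) {M : MaximalSpectrum R}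
    {I : Ideal R} {t : FractionRing R} (ht : t ∈ mulInto (localAt M.asIdeal) I) :
    ∃ c ∉ M.asIdeal, ι c * t ∈ mulInto ⊥ I := by
  obtain ⟨a, b, hb, rfl⟩ := IsFractionRing.div_surjective (A := R) t
  obtain ⟨c, hc, hcb⟩ := h M b (nonZeroDivisors.ne_zero hb)
  refine ⟨c, hc, fun i hi => mem_bot_iff_forall_localAt.2 fun N => ?_⟩
  rcases eq_or_ne N M with rfl | hN
  · rw [mul_assoc]
    exact mul_mem (Subalgebra.algebraMap_mem _ _) (ht i hi)
  · rw [← mul_div_assoc, mul_div_right_comm]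
    exact mul_mem (mul_mem (hcb N hN) (Subalgebra.algebraMap_mem _ _))
      (Subalgebra.algebraMap_mem _ _)

lemma HasSeparators.memLocalV_of_mem (h : HasSeparators R) {M : MaximalSpectrum R} {I : Ideal R}
    {z : R} (hz : z ∈ vIdeal I) : MemLocalV M.asIdeal I z := by
  intro t ht
  obtain ⟨c, hc, hct⟩ := h.exists_mul_mem_mulInto ht
  refine mem_localAt_of_mul_mem hc ?_
  rw [← mul_assoc]
  exact bot_le (a := localAt M.asIdeal) (hz _ hct)

lemma HasSeparators.exists_mul_mem_vIdeal (h : HasSeparators R) {M : MaximalSpectrum R}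
    {I : Ideal R} (hI : I ≠ ⊥) {z : R} (hz : MemLocalV M.asIdeal I z) :
    MemLocally M.asIdeal (vIdeal I) z := by
  obtain ⟨x, hx, hx0⟩ := Submodule.exists_mem_ne_zero_of_ne_bot hI
  obtain ⟨c, hc, hcx⟩ := h M x hx0
  refine ⟨c, hc, fun t ht => mem_bot_iff_forall_localAt.2 fun N => ?_⟩
  rcases eq_or_ne N M with rfl | hN
  · rw [map_mul, mul_left_comm]
    exact mul_mem (Subalgebra.algebraMap_mem _ _) (hz t (mulInto_bot_subset _ _ ht))
  · have hx' := algebraMap_ne_zero hx0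
    -- At N ≠ M, x ∈ I makes tx integral, and c was chosen to absorb the denominator x.
    have : t * ι (c * z) = (ι c / ι x) * (t * ι x) * ι z := by
      rw [map_mul]
      field_simp
    rw [this]
    exact mul_mem (mul_mem (hcx N hN) (mulInto_bot_subset _ _ ht x hx))
      (Subalgebra.algebraMap_mem _ _)

lemma HasSeparators.isDivisorial_iff (h : HasSeparators R) {I : Ideal R} (hI : I ≠ ⊥) :
    IsDivisorial I ↔ ∀ M : MaximalSpectrum R, IsDivisorialAt I M := by
  rw [isDivisorial_iff_vIdeal_le hI]
  constructor
  · intro hv M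
    rw [isDivisorialAt_iff hI]
    intro z hz
    obtain ⟨c, hc, hcz⟩ := h.exists_mul_mem_vIdeal hI hz
    exact ⟨c, hc, hv hcz⟩
  · intro hM z hz
    exact mem_of_forall_memLocally fun M =>
      (isDivisorialAt_iff hI M).1 (hM M) z (h.memLocalV_of_mem hz)

lemma exists_memLocalV_of_not_isDivisorialAt {I : Ideal R} (hI : I ≠ ⊥) {M : MaximalSpectrum R}
    (hM : ¬ IsDivisorialAt I M) : ∃ z, MemLocalV M.asIdeal I z ∧ ¬ MemLocally M.asIdeal I z := by
  rw [isDivisorialAt_iff hI] at hM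
  push Not at hM
  exact hM

lemma exists_mem_prod_notMem {T : Finset (MaximalSpectrum R)} {M : MaximalSpectrum R}
    (hM : M ∉ T) : ∃ s ∈ ∏ N ∈ T, N.asIdeal, s ∉ M.asIdeal := by
  refine SetLike.not_le_iff_exists.1 fun hle => ?_
  obtain ⟨N, hN, hNM⟩ := (Ideal.IsPrime.prod_le inferInstance).1 hle
  exact hM (MaximalSpectrum.ext (N.isMaximal.eq_of_le M.isMaximal.ne_top hNM) ▸ hN)

lemma IsHLocal.finite_not_isDivisorialAt (h : IsHLocal R) {I : Ideal R} (hI : I ≠ ⊥) :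
    {M : MaximalSpectrum R | ¬ IsDivisorialAt I M}.Finite := by
  obtain ⟨x, hx, hx0⟩ := Submodule.exists_mem_ne_zero_of_ne_bot hI
  refine (h.1 x hx0).subset fun M hM => ?_
  by_contra hxM
  exact hM (isDivisorialAt_of_not_le hI fun hle => hxM (hle hx))

lemma IsHLocal.hasStrongFactorization (hR : IsPruferDomain R) (h : IsHLocal R) :
    HasStrongFactorization R := by
  classical
  intro I hI
  have hs := h.hasSeparators
  have hfin := h.finite_not_isDivisorialAt hI
  have hmem : ∀ M, M ∈ hfin.toFinset ↔ ¬ IsDivisorialAt I M := by simp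
  refine ⟨hfin.toFinset, fun M => ?_, ?_, fun T hT => ?_⟩
  · rw [hmem]
    refine ⟨fun hM => ⟨?_, ?_, hM⟩, fun hM => hM.2.2⟩
    · by_contra hle
      exact hM (isDivisorialAt_of_not_le hI hle)
    · exact fun hdiv => hM (isDivisorialAt_of_isDivisorial hR hdiv hI)
  · rw [divisorialClosure_eq hI, ← FractionalIdeal.coeIdeal_mul, FractionalIdeal.coeIdeal_inj]
    refine le_antisymm (fun y hy => mem_of_forall_memLocally fun M => ?_)
      (Ideal.mul_le.2 fun z hz p hp => mem_of_forall_memLocally fun M => ?_)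
    · by_cases hM : M ∈ hfin.toFinset
      · obtain ⟨z, hz, hzI⟩ := exists_memLocalV_of_not_isDivisorialAt hI ((hmem M).1 hM)
        obtain ⟨s, hs', m, hm, e⟩ := exists_mul_eq_of_not_memLocally hR hy hzI
        obtain ⟨c, hc, hcz⟩ := hs.exists_mul_mem_vIdeal hI hz
        -- The other factors of the product become trivial at M: u lies in all of them but not in M.
        obtain ⟨u, hu, huM⟩ := exists_mem_prod_notMem (Finset.notMem_erase M hfin.toFinset)
        refine ⟨c * u * s, M.asIdeal.primeCompl.mul_mem (M.asIdeal.primeCompl.mul_mem hc huM) hs',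
          ?_⟩
        rw [← Finset.mul_prod_erase _ _ hM,
          show c * u * s * y = c * z * (m * u) by rw [mul_assoc _ s, e]; ring]
        exact Ideal.mul_mem_mul hcz (Ideal.mul_mem_mul hm hu)
      · obtain ⟨u, hu, huM⟩ := exists_mem_prod_notMem hM
        exact ⟨u, huM, by rw [mul_comm u]; exact Ideal.mul_mem_mul (le_vIdeal I hy) hu⟩
    · have hzM := hs.memLocalV_of_mem (M := M) hz
      by_cases hM : M ∈ hfin.toFinset
      · exact hzM.mul_mem hR ((Ideal.prod_le_inf.trans (Finset.inf_le hM)) hp)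
      · rw [hmem, not_not] at hM
        obtain ⟨s, hs', hsz⟩ := (isDivisorialAt_iff hI M).1 hM z hzM
        exact ⟨s, hs', by rw [← mul_assoc]; exact I.mul_mem_right p hsz⟩
  · rw [divisorialClosure_eq hI, ← FractionalIdeal.coeIdeal_mul, Ne, FractionalIdeal.coeIdeal_inj]
    intro e
    obtain ⟨M, hM, hMT⟩ := Finset.exists_of_ssubset hT
    obtain ⟨z, hz, hzI⟩ := exists_memLocalV_of_not_isDivisorialAt hI ((hmem M).1 hM)
    obtain ⟨c, hc, hcz⟩ := hs.exists_mul_mem_vIdeal hI hz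
    obtain ⟨u, hu, huM⟩ := exists_mem_prod_notMem hMT
    refine hzI ⟨c * u, M.asIdeal.primeCompl.mul_mem hc huM, ?_⟩
    rw [e, mul_right_comm]
    exact Ideal.mul_mem_mul hcz hu

end HLocal

/-! ### Nonmaximal primes are locally divisorial -/

section LocallyDivisorial

variable {R : Type*} [CommRing R] [IsDomain R]

local notation "ι" => algebraMap R (FractionRing R)

/-- The closure satisfies s (I R_M)^v ⊆ I R_M ⊆ s I R_M, and s cancels. -/
lemma isDivisorialAt_of_div (hR : IsPruferDomain R) {I : Ideal R} (hI : I ≠ ⊥)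
    {M : MaximalSpectrum R} {s : R} (hs : s ∈ M.asIdeal) (hs0 : s ≠ 0)
    (h : ∀ i ∈ I, ∃ u ∉ M.asIdeal, ∃ j ∈ I, u * i = s * j) : IsDivisorialAt I M := by
  rw [isDivisorialAt_iff hI]
  intro z hz
  obtain ⟨c, hc, hi⟩ := MemLocalV.mul_mem hR hz hs
  obtain ⟨u, hu, j, hj, e⟩ := h _ hi
  refine ⟨u * c, M.asIdeal.primeCompl.mul_mem hu hc, ?_⟩
  have : u * c * z = j := mul_left_cancel₀ hs0 (by rw [← e]; ring)
  rwa [this]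

lemma exists_mul_eq_of_mem_of_notMem (hR : IsPruferDomain R) {P N : Ideal R} [P.IsPrime]
    [N.IsPrime] (hPN : P ≤ N) {p v : R} (hp : p ∈ P) (hv : v ∉ P) :
    ∃ u ∉ N, ∃ j ∈ P, u * p = v * j := by
  rcases eq_or_ne p 0 with rfl | hp0
  · exact ⟨1, N.one_notMem, 0, P.zero_mem, by simp⟩
  rcases hR.mem_or_inv_mem N (ι p / ι v) with h | h
  · obtain ⟨u, hu, j, hj⟩ := (div_mem_localAt_iff (ne_zero_of_notMem hv)).1 h
    exact ⟨u, hu, j, (Ideal.IsPrime.mem_or_mem ‹P.IsPrime›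
      (hj ▸ P.mul_mem_left u hp)).resolve_left hv, hj⟩
  · rw [inv_div, div_mem_localAt_iff hp0] at h
    obtain ⟨c, hc, r, hr⟩ := h
    have : c * v ∈ P := hr ▸ P.mul_mem_right r hp
    exact ((Ideal.IsPrime.mem_or_mem ‹P.IsPrime› this).elim (fun h => hc (hPN h)) hv).elim

lemma isDivisorialAt_of_isPrime (hR : IsPruferDomain R) {P : Ideal R} [P.IsPrime] (hP : P ≠ ⊥)
    {M : MaximalSpectrum R} (hM : ¬ M.asIdeal ≤ P) : IsDivisorialAt P M := by
  by_cases hPM : P ≤ M.asIdeal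
  swap
  · exact isDivisorialAt_of_not_le hP hPM
  obtain ⟨s, hs, hsP⟩ := SetLike.not_le_iff_exists.1 hM
  exact isDivisorialAt_of_div hR hP hs (ne_zero_of_notMem hsP) fun i hi =>
    exists_mul_eq_of_mem_of_notMem hR hPM hi hsP

/-! ### The ideals x R_M ∩ R -/

/-- The ideal `x R_P ∩ R`. -/
noncomputable def localSpan (P : Ideal R) [P.IsPrime] (x : R) : Ideal R where
  carrier := {z | ι z / ι x ∈ localAt P}
  zero_mem' := by simp
  add_mem' {y z} hy hz := by
    rw [Set.mem_ofPred, map_add, add_div]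
    exact add_mem hy hz
  smul_mem' c z hz := by
    rw [Set.mem_ofPred, smul_eq_mul, map_mul, mul_div_assoc]
    exact mul_mem (Subalgebra.algebraMap_mem _ c) hz

lemma mem_localSpan {P : Ideal R} [P.IsPrime] {x z : R} :
    z ∈ localSpan P x ↔ ι z / ι x ∈ localAt P := Iff.rfl

lemma self_mem_localSpan {P : Ideal R} [P.IsPrime] {x : R} (hx : x ≠ 0) : x ∈ localSpan P x := by
  rw [mem_localSpan, div_self (algebraMap_ne_zero hx)]
  exact one_mem _

lemma localSpan_ne_bot {P : Ideal R} [P.IsPrime] {x : R} (hx : x ≠ 0) : localSpan P x ≠ ⊥ :=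
  fun h => hx ((Submodule.eq_bot_iff _).1 h x (self_mem_localSpan hx))

lemma mem_localSpan_of_mul_mem {P : Ideal R} [P.IsPrime] {s x z : R} (hs : s ∉ P)
    (h : s * z ∈ localSpan P x) : z ∈ localSpan P x := by
  rw [mem_localSpan, map_mul, mul_div_assoc] at h
  exact mem_localAt_of_mul_mem hs h

/-- At M the ideal becomes principal. At N ≠ M, any s ∈ N∖M is a unit of R_M, so if the ideal lies
in N, it is divisible by s in R_N. -/
lemma isDivisorialAt_localSpan (hR : IsPruferDomain R) {x : R} (hx : x ≠ 0)
    (M N : MaximalSpectrum R) : IsDivisorialAt (localSpan M.asIdeal x) N := by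
  have hI := localSpan_ne_bot (P := M.asIdeal) hx
  rcases eq_or_ne N M with rfl | hNM
  · rw [isDivisorialAt_iff hI]
    intro z hz
    refine memLocally_of_mem ?_
    rw [mem_localSpan, div_eq_inv_mul]
    refine hz _ fun i hi => ?_
    rw [← div_eq_inv_mul]
    exact hi
  by_cases hle : localSpan M.asIdeal x ≤ N.asIdeal
  swap
  · exact isDivisorialAt_of_not_le hI hle
  obtain ⟨s, hs, hsM⟩ := exists_notMem_of_ne hNM
  have hs0 := ne_zero_of_notMem hsM
  refine isDivisorialAt_of_div hR hI hs hs0 fun i hi => ?_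
  rcases eq_or_ne i 0 with rfl | hi0
  · exact ⟨1, N.asIdeal.one_notMem, 0, zero_mem _, by simp⟩
  rcases hR.mem_or_inv_mem N.asIdeal (ι i / ι s) with h | h
  · obtain ⟨u, hu, j, hj⟩ := (div_mem_localAt_iff hs0).1 h
    exact ⟨u, hu, j, mem_localSpan_of_mul_mem hsM (hj ▸ Ideal.mul_mem_left _ u hi), hj⟩
  · rw [inv_div, div_mem_localAt_iff hi0] at h
    obtain ⟨c, hc, r, hr⟩ := h
    refine (hc (hle (mem_localSpan_of_mul_mem hsM ?_))).elim
    rw [mul_comm, hr]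
    exact Ideal.mul_mem_right _ _ hi

/-! ### Finite character from condition 4 -/

/-- Every nonzero locally divisorial ideal is divisorial. -/
def DivisorialOfLocal (R : Type*) [CommRing R] [IsDomain R] : Prop :=
  ∀ I : Ideal R, I ≠ ⊥ → (∀ M : MaximalSpectrum R, IsDivisorialAt I M) → IsDivisorial I

lemma vIdeal_localSpan_le (hR : IsPruferDomain R) (h : DivisorialOfLocal R) (M : MaximalSpectrum R)
    {x : R} (hx : x ≠ 0) : vIdeal (localSpan M.asIdeal x) ≤ localSpan M.asIdeal x :=
  (isDivisorial_iff_vIdeal_le (localSpan_ne_bot hx)).1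
    (h _ (localSpan_ne_bot hx) (isDivisorialAt_localSpan hR hx M))

/-- Let Θ be the intersection of the R_N, N ≠ M, and J = x R_M ∩ R. If xΘ ⊆ R_M, then xΘ ⊆ R; as (R
: J) ⊆ Θ, this gives xΘ ⊆ J^v = J, so Θ ⊆ R_M. Then (R : J) ⊆ R and 1 ∈ J, against x ∈ M. -/
lemma exists_mem_localAt_mul_notMem (hR : IsPruferDomain R) (h : DivisorialOfLocal R)
    {M : MaximalSpectrum R} (hM : ∀ N ≠ M, ∀ Q : Ideal R, Q.IsPrime → Q ≤ N.asIdeal →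
      Q ≤ M.asIdeal → Q = ⊥) {x : R} (hx : x ≠ 0) (hxM : x ∈ M.asIdeal) :
    ∃ t, (∀ N ≠ M, t ∈ localAt N.asIdeal) ∧ t * ι x ∉ localAt M.asIdeal := by
  by_contra! hcon
  have hle := vIdeal_localSpan_le hR h M hx
  have hx' := algebraMap_ne_zero hx
  have hinv : ∀ t ∈ mulInto ⊥ (localSpan M.asIdeal x), ∀ N ≠ M, t ∈ localAt N.asIdeal := by
    intro t ht N hN
    obtain ⟨c, hc, hcx⟩ := exists_div_mem_localAt (M := N) (N := M) (hM N hN) hx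
    exact mem_localAt_of_mem_mulInto (mulInto_bot_subset _ _ ht) (mem_localSpan.2 hcx) hc
  have hbot : ∀ t, (∀ N ≠ M, t ∈ localAt N.asIdeal) →
      t * ι x ∈ (⊥ : Subalgebra R (FractionRing R)) := by
    intro t ht
    rw [mem_bot_iff_forall_localAt]
    intro N
    rcases eq_or_ne N M with rfl | hN
    · exact hcon t ht
    · exact mul_mem (ht N hN) (Subalgebra.algebraMap_mem _ _)
  have hΘ : ∀ t, (∀ N ≠ M, t ∈ localAt N.asIdeal) → t ∈ localAt M.asIdeal := by
    intro t ht
    obtain ⟨z, hz⟩ := Algebra.mem_bot.1 (hbot t ht)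
    have hzI : z ∈ localSpan M.asIdeal x := hle fun t' ht' => by
      rw [hz, ← mul_assoc]
      exact hbot _ fun N hN => mul_mem (hinv t' ht' N hN) (ht N hN)
    rwa [mem_localSpan, hz, mul_div_cancel_right₀ _ hx'] at hzI
  have h1 : 1 ∈ localSpan M.asIdeal x := hle fun t ht => by
    rw [map_one, mul_one, mem_bot_iff_forall_localAt]
    intro N
    rcases eq_or_ne N M with rfl | hN
    · exact hΘ t (hinv t ht)
    · exact hinv t ht N hN
  rw [mem_localSpan, map_one, one_div, algebraMap_notMem_iff hx] at h1
  exact h1 hxM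

lemma exists_notMem_forall_ne_mem (hR : IsPruferDomain R) (h : DivisorialOfLocal R)
    {M : MaximalSpectrum R} (hM : ∀ N ≠ M, ∀ Q : Ideal R, Q.IsPrime → Q ≤ N.asIdeal →
      Q ≤ M.asIdeal → Q = ⊥) {x : R} (hx : x ≠ 0) (hxM : x ∈ M.asIdeal) :
    ∃ s ∉ M.asIdeal, ∀ N ≠ M, x ∈ N.asIdeal → s ∈ N.asIdeal := by
  obtain ⟨t, ht, htx⟩ := exists_mem_localAt_mul_notMem hR h hM hx hxM
  have htx0 : t * ι x ≠ 0 := fun h0 => htx (h0 ▸ zero_mem _)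
  -- Since 1/(tx) ∈ R_M, some s ∉ M has s = mtx; as t ∈ R_N, this s lies in x R_N for N ≠ M.
  obtain ⟨s, hs, m, hm⟩ := mem_localAt.1 ((hR.mem_or_inv_mem M.asIdeal (t * ι x)).resolve_left htx)
  have e : ι m * (t * ι x) = ι s := by
    rw [← hm, mul_assoc, inv_mul_cancel₀ htx0, mul_one]
  refine ⟨s, hs, fun N hN hxN => ?_⟩
  obtain ⟨u, hu, a, ha⟩ := mem_localAt.1 (ht N hN)
  have e' : u * s = m * a * x := by
    apply IsFractionRing.injective R (FractionRing R)
    rw [map_mul, map_mul, map_mul, ← e, ← ha]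
    ring
  have : u * s ∈ N.asIdeal := e' ▸ N.asIdeal.mul_mem_left _ hxN
  exact (Ideal.IsPrime.mem_or_mem inferInstance this).resolve_left hu

lemma hasFiniteCharacter_of_separated
    (h : ∀ (x : R) (M : MaximalSpectrum R), x ≠ 0 → x ∈ M.asIdeal →
      ∃ s ∉ M.asIdeal, ∀ N ≠ M, x ∈ N.asIdeal → s ∈ N.asIdeal) : HasFiniteCharacter R := by
  intro x hx
  choose! s hs hsN using fun M => h x M hx
  have htop : Ideal.span (insert x (s '' {M | x ∈ M.asIdeal})) = ⊤ := by
    by_contra hne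
    obtain ⟨N, hN, hle⟩ := Ideal.exists_le_maximal _ hne
    have hxN : x ∈ N := hle (Ideal.subset_span (Set.mem_insert _ _))
    exact hs ⟨N, hN⟩ hxN (hle (Ideal.subset_span (Set.mem_insert_of_mem _ ⟨⟨N, hN⟩, hxN, rfl⟩)))
  -- Finitely many generators suffice. If s M were not among them, all would lie in M; so each s M
  -- is in T, and s is injective on these M.
  obtain ⟨T, hT, h1⟩ := Submodule.mem_span_finite_of_mem_span
    (htop ▸ Submodule.mem_top : (1 : R) ∈ Ideal.span (insert x (s '' {M | x ∈ M.asIdeal})))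
  refine Set.Finite.of_finite_image (f := s) (T.finite_toSet.subset ?_) ?_
  · rintro _ ⟨M, hM, rfl⟩
    by_contra hMT
    suffices hle : Ideal.span (T : Set R) ≤ M.asIdeal from M.asIdeal.one_notMem (hle h1)
    refine Ideal.span_le.2 fun y hy => ?_
    rcases hT hy with rfl | ⟨N, hN, rfl⟩
    · exact hM
    · refine hsN N hN M ?_ hM
      rintro rfl
      exact hMT hy
  · intro M hM N hN e
    by_contra hne
    exact hs M hM (e ▸ hsN N hN M hne hM)

/-! ### Distinct maximal ideals share no nonzero prime -/

lemma le_total_of_isPrime_of_le (hR : IsPruferDomain R) {P Q M : Ideal R} [P.IsPrime] [Q.IsPrime]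
    [M.IsPrime] (hP : P ≤ M) (hQ : Q ≤ M) : P ≤ Q ∨ Q ≤ P := by
  by_contra! hcon
  obtain ⟨a, haP, haQ⟩ := SetLike.not_le_iff_exists.1 hcon.1
  obtain ⟨b, hbQ, hbP⟩ := SetLike.not_le_iff_exists.1 hcon.2
  obtain ⟨u, hu, j, hj, e⟩ := exists_mul_eq_of_mem_of_notMem hR hP haP hbP
  have : u * a ∈ Q := e ▸ Q.mul_mem_right j hbQ
  exact (Ideal.IsPrime.mem_or_mem ‹Q.IsPrime› this).elim (fun h => hu (hQ h)) haQ

/-- Primes inside M form a chain, so the union of those in M ∩ N is prime. -/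
lemma exists_greatest_prime_le (hR : IsPruferDomain R) {M N Q : Ideal R} [M.IsPrime]
    (hQ : Q.IsPrime) (hQM : Q ≤ M) (hQN : Q ≤ N) :
    ∃ P : Ideal R, P.IsPrime ∧ P ≤ M ∧ P ≤ N ∧ Q ≤ P ∧
      ∀ Q' : Ideal R, Q'.IsPrime → Q' ≤ M → Q' ≤ N → Q' ≤ P := by
  let S : Set (Ideal R) := {P | P.IsPrime ∧ P ≤ M ∧ P ≤ N}
  have hchain : IsChain (· ≤ ·) S := by
    rintro P ⟨hP, hPM, -⟩ P' ⟨hP', hPM', -⟩ -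
    exact le_total_of_isPrime_of_le hR hPM hPM'
  have hne : S.Nonempty := ⟨Q, hQ, hQM, hQN⟩
  refine ⟨sSup S, ?_, sSup_le fun P hP => hP.2.1, sSup_le fun P hP => hP.2.2,
    le_sSup ⟨hQ, hQM, hQN⟩, fun Q' h1 h2 h3 => le_sSup ⟨h1, h2, h3⟩⟩
  have hmem : ∀ {x}, x ∈ sSup S ↔ ∃ P ∈ S, x ∈ P :=
    fun {x} => Submodule.mem_sSup_of_directed hne hchain.directedOn
  refine ⟨fun h => ?_, fun {x y} hxy => ?_⟩
  · obtain ⟨P, hP, h1⟩ := hmem.1 ((Ideal.eq_top_iff_one _).1 h)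
    exact hP.1.ne_top ((Ideal.eq_top_iff_one _).2 h1)
  · obtain ⟨P, hP, hxy⟩ := hmem.1 hxy
    exact (hP.1.mem_or_mem hxy).imp (fun h => hmem.2 ⟨P, hP, h⟩) fun h => hmem.2 ⟨P, hP, h⟩

variable {P : Ideal R} [P.IsPrime]

/-- If `P` is the greatest prime in `M ∩ N`, then `x (R : x R_M ∩ R) ⊆ P` for `x ∈ P`. -/
lemma mem_of_mulInto_localSpan (hR : IsPruferDomain R) {M N : Ideal R} [M.IsPrime] [N.IsPrime]
    (hPN : P ≤ N) (hNP : ¬ N ≤ P)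
    (hP : ∀ Q : Ideal R, Q.IsPrime → Q ≤ M → Q ≤ N → Q ≤ P) {x : R} (hx : x ≠ 0) (hxP : x ∈ P)
    {t : FractionRing R} (ht : t ∈ mulInto ⊥ (localSpan M x)) {y : R} (e : t * ι x = ι y) :
    y ∈ P := by
  by_contra hy
  obtain ⟨g, hg, hgP⟩ := SetLike.not_le_iff_exists.1 hNP
  have hyg : y * g ∉ P := P.primeCompl.mul_mem hy hgP
  obtain ⟨m, hm, n, hn, d, hd⟩ := exists_dvd_mul_of_notMem hP hyg
  obtain ⟨u, hu, j, hj, e1⟩ := exists_mul_eq_of_mem_of_notMem hR hPN hxP hyg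
  have hy0 := algebraMap_ne_zero (ne_zero_of_notMem hy)
  have hyg0 := ne_zero_of_notMem hyg
  -- Here j = ux/(yg), so m(nj) is a multiple of x. With t = y/x, tnj = nu/g must be in R,
  -- impossible since g ∈ N and nu ∉ N.
  have hnj : n * j ∈ localSpan M x := by
    rw [mem_localSpan, div_mem_localAt_iff hx]
    refine ⟨m, hm, u * d, mul_left_cancel₀ hyg0 ?_⟩
    linear_combination (m * n) * (-e1) + u * x * hd
  obtain ⟨k, hk⟩ := Algebra.mem_bot.1 (ht _ hnj)
  have : n * u = g * k := by
    apply IsFractionRing.injective R (FractionRing R)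
    have e1' := congrArg ι e1
    simp only [map_mul] at e1' hk ⊢
    rw [hk]
    apply mul_left_cancel₀ hy0
    linear_combination (-(ι n * ι u)) * e + ι n * t * e1'
  exact (N.primeCompl.mul_mem hn hu) (show n * u ∈ N from this ▸ N.mul_mem_right k hg)

/-- For x ∈ P and J = x R_M ∩ R one has x(R : J) ⊆ P. Hence sx(R : J) ⊆ sP ⊆ R, so sx ∈ J^v = J and
s ∈ R_M. -/
lemma mulInto_subset_localAt (hR : IsPruferDomain R) (h : DivisorialOfLocal R) (hP0 : P ≠ ⊥)
    {M N : MaximalSpectrum R} (hPN : P ≤ N.asIdeal) (hNP : ¬ N.asIdeal ≤ P)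
    (hP : ∀ Q : Ideal R, Q.IsPrime → Q ≤ M.asIdeal → Q ≤ N.asIdeal → Q ≤ P) {s : FractionRing R}
    (hs : s ∈ mulInto ⊥ P) : s ∈ localAt M.asIdeal := by
  obtain ⟨x, hxP, hx⟩ := Submodule.exists_mem_ne_zero_of_ne_bot hP0
  have hx' := algebraMap_ne_zero hx
  obtain ⟨z, hz⟩ := Algebra.mem_bot.1 (hs x hxP)
  have hzI : z ∈ localSpan M.asIdeal x := by
    refine vIdeal_localSpan_le hR h M hx fun t ht => ?_
    obtain ⟨y, hy⟩ := Algebra.mem_bot.1 (ht x (self_mem_localSpan hx))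
    have hyP := mem_of_mulInto_localSpan hR hPN hNP hP hx hxP ht hy.symm
    rw [hz, mul_left_comm, ← hy]
    exact hs y hyP
  rw [mem_localSpan, hz, mul_div_cancel_right₀ _ hx'] at hzI
  exact hzI

lemma eq_bot_of_le_of_le (hR : IsPruferDomain R) (h : DivisorialOfLocal R)
    {M N : MaximalSpectrum R} (hMN : M ≠ N) {Q : Ideal R} (hQ : Q.IsPrime) (hQM : Q ≤ M.asIdeal)
    (hQN : Q ≤ N.asIdeal) : Q = ⊥ := by
  by_contra hQ0
  obtain ⟨P, hP, hPM, hPN, hQP, hmax⟩ := exists_greatest_prime_le hR hQ hQM hQN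
  have hP0 : P ≠ ⊥ := ne_bot_of_le_ne_bot hQ0 hQP
  have key : ∀ {A B : MaximalSpectrum R}, A.asIdeal ≤ B.asIdeal → A = B := fun {A B} hle =>
    MaximalSpectrum.ext (A.isMaximal.eq_of_le B.isMaximal.ne_top hle)
  have hnot : ∀ A : MaximalSpectrum R, ¬ A.asIdeal ≤ P := fun A hA =>
    hMN ((key (hA.trans hPM)).symm.trans (key (hA.trans hPN)))
  have hdiv := (isDivisorial_iff_vIdeal_le hP0).1
    (h P hP0 fun A => isDivisorialAt_of_isPrime hR hP0 (hnot A))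
  have h1 : 1 ∉ vIdeal P := fun h1 => P.one_notMem (hdiv h1)
  rw [mem_vIdeal] at h1
  push Not at h1
  obtain ⟨s, hs, hs1⟩ := h1
  rw [map_one, mul_one, mem_bot_iff_forall_localAt] at hs1
  push Not at hs1
  obtain ⟨A, hA⟩ := hs1
  -- A is compared with M or, failing that, with N. A prime Q₁ ⊆ A ∩ M outside P cannot lie in N;
  -- being comparable with every prime Q₂ ⊆ A ∩ N, it contains Q₂, so Q₂ ⊆ M ∩ N.
  by_cases hAM : ∀ Q : Ideal R, Q.IsPrime → Q ≤ A.asIdeal → Q ≤ M.asIdeal → Q ≤ P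
  · exact hA (mulInto_subset_localAt hR h hP0 hPM (hnot M) hAM hs)
  refine hA (mulInto_subset_localAt hR h hP0 hPN (hnot N) (fun Q₂ hQ₂ h2A h2N => ?_) hs)
  push Not at hAM
  obtain ⟨Q₁, hQ₁, h1A, h1M, h1P⟩ := hAM
  rcases le_total_of_isPrime_of_le hR h1A h2A with hle | hle
  · exact (h1P (hmax Q₁ hQ₁ h1M (hle.trans h2N))).elim
  · exact hmax Q₂ hQ₂ (hle.trans h1M) h2N

lemma DivisorialOfLocal.isHLocal (hR : IsPruferDomain R) (h : DivisorialOfLocal R) :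
    IsHLocal R := by
  refine ⟨hasFiniteCharacter_of_separated fun x M hx hxM =>
    exists_notMem_forall_ne_mem hR h (fun N hN Q hQ h1 h2 => eq_bot_of_le_of_le hR h hN hQ h1 h2)
      hx hxM, fun Q hQ hQ0 => ?_⟩
  obtain ⟨M, hM, hle⟩ := Ideal.exists_le_maximal Q hQ.ne_top
  refine ⟨⟨M, hM⟩, hle, fun N hN => ?_⟩
  by_contra hne
  exact hQ0 (eq_bot_of_le_of_le hR h hne hQ hN hle)

lemma HasStrongFactorization.divisorialOfLocal (h : HasStrongFactorization R) :
    DivisorialOfLocal R := by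
  intro I hI hdiv
  obtain ⟨S, hS, e, -⟩ := h I hI
  have : S = ∅ := Finset.eq_empty_of_forall_notMem fun M hM => ((hS M).1 hM).2.2 (hdiv M)
  rw [this, Finset.prod_empty, Ideal.one_eq_top, FractionalIdeal.coeIdeal_top, mul_one] at e
  exact e.symm

end LocallyDivisorial

theorem mainTheorem1 {R : Type*} [CommRing R] [IsDomain R] (hR : IsPruferDomain R) :
    List.TFAE [
      IsHLocal R,
      HasStrongFactorization R,
      ∀ I : Ideal R, I ≠ ⊥ → (IsDivisorial I ↔ ∀ M : MaximalSpectrum R, IsDivisorialAt I M),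
      ∀ I : Ideal R, I ≠ ⊥ → (∀ M : MaximalSpectrum R, IsDivisorialAt I M) → IsDivisorial I] := by
  tfae_have 1 → 2 := IsHLocal.hasStrongFactorization hR
  tfae_have 2 → 4 := HasStrongFactorization.divisorialOfLocal
  tfae_have 1 → 3 := fun h _ hI => h.hasSeparators.isDivisorial_iff hI
  tfae_have 3 → 4 := fun h I hI => (h I hI).2
  tfae_have 4 → 1 := DivisorialOfLocal.isHLocal hR
  tfae_finish
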